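/- Let $\mathcal H\neq\{0\}$ be a complex Hilbert space, let $\lambda\in\mathbb R\setminus\{-1,0\}$, and let $T$ be a bounded self-adjoint operator on $\mathcal H$ which is in generic position with respect to $\lambda$, that is, $\ker T=\ker(T-I)=\ker(T-\lambda I)=\ker(T-(1+\lambda)I)=\{0\}$. For bounded self-adjoint operators $A,B$ on a Hilbert space write $A<B$ if $B-A$ is positive (semidefinite) and injective. Then the following are equivalent: 1. there are nonzero orthogonal projections $P,Q$ on $\mathcal H$ with $T=\lambda P+Q$; 2. there are a complex Hilbert space $\mathcal K$ and a bounded positive operator $B$ on $\mathcal K$ with $$\frac{|1-|\lambda||}{2}I<B<\frac{1+|\lambda|}{2}I$$ such that $T-\frac{1+\lambda}{2}I$ is unitarily equivalent to the operator $B\oplus(-B)$ on $\mathcal K\oplus\mathcal K$. -/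

import Mathlib

universe u

namespace PencilOfProjections

/-- The strict order on bounded self-adjoint operators: `A < B` means that `B - A` is positive
and injective. -/
def StrictLess {K : Type*} [NormedAddCommGroup K] [InnerProductSpace ℂ K]
    (A B : K →L[ℂ] K) : Prop :=
  (B - A).IsPositive ∧ Function.Injective (B - A)

/-- `T` is in generic position with respect to `l`: the null spaces of `T`, `T - I`, `T - l I`
and `T - (1 + l) I` are all trivial. -/
def IsInGenericPosition {H : Type*} [NormedAddCommGroup H] [InnerProductSpace ℂ H]
    (T : H →L[ℂ] H) (l : ℝ) : Prop :=
  T.ker = ⊥ ∧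
  (T - ContinuousLinearMap.id ℂ H).ker = ⊥ ∧
  (T - (l : ℂ) • ContinuousLinearMap.id ℂ H).ker = ⊥ ∧
  (T - (1 + l : ℂ) • ContinuousLinearMap.id ℂ H).ker = ⊥

/-- `T` is the pencil at `l` of a pair `(P, Q)` of nonzero orthogonal projections:
`T = l P + Q`. -/
def IsPencilAt {H : Type*} [NormedAddCommGroup H] [InnerProductSpace ℂ H] [CompleteSpace H]
    (T : H →L[ℂ] H) (l : ℝ) : Prop :=
  ∃ P Q : H →L[ℂ] H, IsStarProjection P ∧ IsStarProjection Q ∧ P ≠ 0 ∧ Q ≠ 0 ∧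
    T = (l : ℂ) • P + Q

/-- The direct sum `A ⊕ B` of two operators, acting on the Hilbert space direct sum by
`(x, y) ↦ (A x, B y)`. -/
noncomputable def directSum {K L : Type*} [NormedAddCommGroup K] [InnerProductSpace ℂ K]
    [NormedAddCommGroup L] [InnerProductSpace ℂ L] (A : K →L[ℂ] K) (B : L →L[ℂ] L) :
    WithLp 2 (K × L) →L[ℂ] WithLp 2 (K × L) :=
  (WithLp.prodContinuousLinearEquiv 2 ℂ K L).symm.toContinuousLinearMap ∘L
    A.prodMap B ∘L (WithLp.prodContinuousLinearEquiv 2 ℂ K L).toContinuousLinearMap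

theorem directSum_apply {K L : Type*} [NormedAddCommGroup K] [InnerProductSpace ℂ K]
    [NormedAddCommGroup L] [InnerProductSpace ℂ L] (A : K →L[ℂ] K) (B : L →L[ℂ] L)
    (z : WithLp 2 (K × L)) : directSum A B z = WithLp.toLp 2 (A z.fst, B z.snd) := rfl

/-- Two operators on Hilbert spaces are unitarily equivalent if a surjective linear isometry
`U` between the spaces intertwines them: `U S = T U`, that is `U S U* = T`. -/
def UnitarilyEquivalent {H L : Type*} [NormedAddCommGroup H] [InnerProductSpace ℂ H]
    [NormedAddCommGroup L] [InnerProductSpace ℂ L] (S : H →L[ℂ] H) (T : L →L[ℂ] L) : Prop :=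
  ∃ U : H ≃ₗᵢ[ℂ] L, ∀ x : H, U (S x) = T (U x)

end PencilOfProjections

namespace PencilOfProjections

/-! ### Polar decomposition of self-adjoint operators. -/

section Polar

open scoped InnerProductSpace

variable {H : Type*} [NormedAddCommGroup H] [InnerProductSpace ℂ H] [CompleteSpace H]

/-! Put `S = T - (1 + l)/2`. With the symmetries `a = 2P - 1` and `b = 2Q - 1`, the pencil equation
reads `2S = l a + b`.

From a pencil to a splitting: the commutator of `P` and `Q` anticommutes with `S`, and generic
position makes it injective, so its polar sign `J` is a self-adjoint unitary anticommuting with `S`.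
Then `J` swaps the spectral subspaces of `S` for positive and negative values, so `S` is `B ⊕ -B`
with `B` the positive part (`exists_splitting`). The triangle inequality for `l a + b` bounds `B`;
the bounds are strict because attaining one would give an eigenvalue of `T` excluded by generic
position.

Conversely, a symmetry `a` is needed for which `2S - l a` is again a symmetry. Try `a = [[M, N], [N,
-M]]` with `M`, `N` functions of `B`. The two conditions become `M² + N² = 1` and `4 l B M = 4 B² +
l² - 1`, which dictates `M = f(B)`; the bounds on `B` say that `|f| ≤ 1` on the spectrum, so `N =
√(1 - f²)(B)` exists (`exists_cos_sin`). -/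

theorem inner_apply_comm {A : H →L[ℂ] H} (hA : IsSelfAdjoint A) (x y : H) :
    ⟪A x, y⟫_ℂ = ⟪x, A y⟫_ℂ :=
  hA.isSymmetric x y

theorem norm_apply_of_isSelfAdjoint_of_mul_self {J : H →L[ℂ] H} (hJ : IsSelfAdjoint J)
    (hJJ : J * J = 1) (x : H) : ‖J x‖ = ‖x‖ := by
  have h1 := inner_apply_comm hJ x (J x)
  have h3 : J (J x) = x := congrArg (fun F : H →L[ℂ] H => F x) hJJ
  rw [h3, inner_self_eq_norm_sq_to_K, inner_self_eq_norm_sq_to_K] at h1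
  have h2 : ‖J x‖ ^ 2 = ‖x‖ ^ 2 := by exact_mod_cast h1
  exact (sq_eq_sq₀ (norm_nonneg _) (norm_nonneg _)).1 h2

theorem range_orthogonal_eq_ker {A : H →L[ℂ] H} (hA : IsSelfAdjoint A) :
    A.rangeᗮ = A.ker := by
  rw [ContinuousLinearMap.orthogonal_range, ← ContinuousLinearMap.star_eq_adjoint, hA.star_eq]

/-- Operators agreeing after composition with an injective self-adjoint operator are equal. -/
theorem eq_of_mul_eq_mul_of_injective {A R S : H →L[ℂ] H} (hA : IsSelfAdjoint A)
    (hinj : ∀ x, A x = 0 → x = 0) (h : R * A = S * A) : R = S := by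
  have hd : DenseRange A := by
    have h1 : A.ker = ⊥ := (Submodule.eq_bot_iff _).2 fun x hx => hinj x hx
    have h2 : A.range.topologicalClosure = ⊤ := by
      rw [Submodule.topologicalClosure_eq_top_iff, range_orthogonal_eq_ker hA, h1]
    exact Submodule.dense_iff_topologicalClosure_eq_top.2 h2
  refine ContinuousLinearMap.ext fun x => ?_
  exact congrFun (hd.equalizer R.continuous S.continuous
    (funext fun y => by simpa using congrArg (fun F : H →L[ℂ] H => F y) h)) x

theorem abs_isSelfAdjoint (A : H →L[ℂ] H) : IsSelfAdjoint (CFC.abs A) :=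
  IsSelfAdjoint.of_nonneg (CFC.abs_nonneg A)

theorem abs_sq_eq {A : H →L[ℂ] H} (hA : IsSelfAdjoint A) :
    CFC.abs A * CFC.abs A = A * A := by
  rw [CFC.abs_mul_abs, hA.star_eq]

/-- `|A|` is a continuous function of `A²`. Asking only for commutation with `A²` covers operators
that anticommute with `A`. -/
theorem commute_abs_of_commute_sq {A R : H →L[ℂ] H} (hA : IsSelfAdjoint A)
    (h : Commute (A * A) R) : Commute (CFC.abs A) R := by
  rw [CFC.abs, CFC.sqrt, hA.star_eq]
  exact h.cfcₙ_nnreal _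

/-- The unitary part of the polar decomposition of an injective self-adjoint operator: it is a
self-adjoint unitary and (skew-)commutes with everything that (skew-)commutes with `A`. -/
theorem exists_polar_sign {A : H →L[ℂ] H} (hA : IsSelfAdjoint A)
    (hinj : ∀ x, A x = 0 → x = 0) :
    ∃ E : H →L[ℂ] H, IsSelfAdjoint E ∧ E * E = 1 ∧ E * CFC.abs A = A ∧
      ∀ (R : H →L[ℂ] H) (e : ℂ), e * e = 1 → R * A = e • (A * R) → R * E = e • (E * R) := by
  set D := CFC.abs A with hD
  have hDs : IsSelfAdjoint D := abs_isSelfAdjoint A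
  have hsq : D * D = A * A := abs_sq_eq hA
  have hcomm : Commute D A := commute_abs_of_commute_sq hA ((Commute.refl A).mul_left (.refl A))
  have hDinj : ∀ x, D x = 0 → x = 0 := fun x hx => hinj x <| hinj _ <| by
    have := congrArg (fun F : H →L[ℂ] H => F x) hsq
    simpa [hx] using this.symm
  -- `E` will be the reflection in `M`; on the orthogonal complement of `M`, `A = -|A|` because `(A
  -- - D)(A + D) = 0`.
  set M : Submodule ℂ H := (A - D).ker with hM
  have hMc : IsClosed (M : Set H) := (A - D).isClosed_ker
  have : CompleteSpace M := hMc.completeSpace_coe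
  have hmem : ∀ x, x ∈ M ↔ A x = D x := fun x => by
    rw [hM, LinearMap.mem_ker]
    simp [sub_eq_zero]
  have hprod : ∀ x, A x + D x ∈ M := fun x => by
    rw [hmem]
    have h1 := congrArg (fun F : H →L[ℂ] H => F x) hsq
    have h2 := congrArg (fun F : H →L[ℂ] H => F x) hcomm.eq
    simp only [mul_apply_eq_comp] at h1 h2
    rw [map_add, map_add, h1, h2, add_comm]
  have hperp : ∀ x ∈ Mᗮ, A x = - D x := fun x hx => by
    have : ∀ y, ⟪(A + D) x, y⟫_ℂ = 0 := fun y => by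
      rw [inner_apply_comm (hA.add hDs)]
      exact Submodule.inner_left_of_mem_orthogonal (hprod y) hx
    have := ext_inner_right ℂ (x := (A + D) x) (y := 0) (fun y => by rw [this y, inner_zero_left])
    exact eq_neg_of_add_eq_zero_left this
  have hperp' : ∀ x, A x = - D x → x ∈ Mᗮ := fun x hx => by
    have hk := M.starProjection_apply_mem x
    have hk' := M.sub_starProjection_mem_orthogonal x
    have h1 := (hmem _).1 hk
    have h2 := hperp _ hk'
    rw [map_sub, map_sub, hx, h1] at h2
    have h3 : M.starProjection x = 0 := hDinj _ <| by
      have : (2 : ℂ) • D (M.starProjection x) = 0 := by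
        rw [two_smul]
        have h4 : -D x - D (M.starProjection x) + (D x - D (M.starProjection x)) = 0 := by
          rw [h2]; abel
        have h5 : -(D (M.starProjection x) + D (M.starProjection x)) = 0 := by
          rw [← h4]; abel
        exact neg_eq_zero.1 h5
      simpa using this
    simpa [h3] using hk'
  have hEself : IsSelfAdjoint ((2 : ℂ) • M.starProjection - 1 : H →L[ℂ] H) := by
    refine IsSelfAdjoint.sub ?_ (.one _)
    exact IsSelfAdjoint.smul (by simp)
      (isSelfAdjoint_starProjection M)
  set E : H →L[ℂ] H := (2 : ℂ) • M.starProjection - 1 with hE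
  have hEE : E * E = 1 := by
    have hp : M.starProjection * M.starProjection = M.starProjection :=
      (Submodule.isIdempotentElem_starProjection M).eq
    rw [hE]
    simp only [sub_mul, mul_sub, smul_mul_assoc, mul_smul_comm, hp, one_mul, mul_one]
    module
  have hE1 : ∀ x ∈ M, E x = x := fun x hx => by
    simp [hE, Submodule.starProjection_eq_self_iff.2 hx, two_smul]
  have hE2 : ∀ x ∈ Mᗮ, E x = -x := fun x hx => by
    simp [hE, (Submodule.starProjection_apply_eq_zero_iff M).2 hx]
  have hED : E * D = A := by
    refine ContinuousLinearMap.ext fun x => ?_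
    have hk := M.starProjection_apply_mem x
    have hk' := M.sub_starProjection_mem_orthogonal x
    have hc : ∀ y, D (A y) = A (D y) := fun y =>
      congrArg (fun F : H →L[ℂ] H => F y) hcomm.eq
    have e1 : E (D (M.starProjection x)) = A (M.starProjection x) := by
      rw [(hmem _).1 hk]
      exact hE1 _ ((hmem _).2 (by rw [← hc, (hmem _).1 hk]))
    have e2 : E (D (x - M.starProjection x)) = A (x - M.starProjection x) := by
      rw [hperp _ hk']
      exact hE2 _ (hperp' _ (by rw [← hc, hperp _ hk', map_neg]))
    have := congrArg₂ (· + ·) e1 e2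
    simp only [← map_add, add_sub_cancel] at this
    exact this
  refine ⟨E, hEself, hEE, hED, fun R e he hR => ?_⟩
  have hR2 : Commute (A * A) R := by
    have : R * (A * A) = A * A * R := by
      rw [← mul_assoc, hR, smul_mul_assoc, mul_assoc, hR, mul_smul_comm, smul_smul, he, one_smul,
        mul_assoc]
    exact this.symm
  have hRD := commute_abs_of_commute_sq hA hR2
  -- Cancel `D` on the right: `R E D = R A = e A R = e E D R = e E R D`.
  refine eq_of_mul_eq_mul_of_injective hDs hDinj ?_
  rw [mul_assoc, hED, hR, smul_mul_assoc, mul_assoc E, ← hRD.eq, ← mul_assoc, ← hD, hED]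

end Polar

/-! ### Splitting an operator that anticommutes with a symmetry. -/

section Splitting

open scoped InnerProductSpace

variable {H : Type u} [NormedAddCommGroup H] [InnerProductSpace ℂ H] [CompleteSpace H]

theorem abs_ofReal_smul_one {c : ℝ} (hc : 0 ≤ c) :
    CFC.abs ((c : ℂ) • (1 : H →L[ℂ] H)) = (c : ℂ) • 1 := by
  refine CFC.abs_of_nonneg _ ?_
  rw [ContinuousLinearMap.nonneg_iff_isPositive]
  exact ContinuousLinearMap.isPositive_one.smul_of_nonneg (by exact_mod_cast hc)

/-- The absolute value is monotone with respect to the pointwise norms. -/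
theorem abs_le_abs_of_norm_le {A B : H →L[ℂ] H} (h : ∀ x, ‖A x‖ ≤ ‖B x‖) :
    CFC.abs A ≤ CFC.abs B := by
  -- The square root is operator monotone, so comparing `A* A` with `B* B` suffices.
  refine CFC.sqrt_le_sqrt _ _ ?_
  rw [ContinuousLinearMap.le_def, ContinuousLinearMap.isPositive_def']
  refine ⟨(IsSelfAdjoint.star_mul_self B).sub (IsSelfAdjoint.star_mul_self A), fun x => ?_⟩
  have key : ∀ C : H →L[ℂ] H, ⟪(star C * C) x, x⟫_ℂ = ((‖C x‖ ^ 2 : ℝ) : ℂ) := fun C => by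
    change ⟪(star C) (C x), x⟫_ℂ = _
    rw [ContinuousLinearMap.star_eq_adjoint, ContinuousLinearMap.adjoint_inner_left,
      inner_self_eq_norm_sq_to_K]
    norm_cast
  rw [ContinuousLinearMap.reApplyInnerSelf_apply, sub_apply, inner_sub_left,
    key, key, ← Complex.ofReal_sub]
  have : ‖A x‖ ^ 2 ≤ ‖B x‖ ^ 2 := by gcongr; exact h x
  simpa only [RCLike.re_to_complex, Complex.ofReal_re, sub_nonneg] using this

/-- An injective self-adjoint operator which anticommutes with a self-adjoint unitary splits as
`B ⊕ (-B)`, with `B` inheriting the bounds of `|S|`. -/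
theorem exists_splitting {S J : H →L[ℂ] H} (hS : IsSelfAdjoint S) (hJ : IsSelfAdjoint J)
    (hJJ : J * J = 1) (hJS : J * S = -(S * J)) {c d : ℝ}
    (hc : 0 ≤ c) (hd : 0 ≤ d) (hcS : ∀ x, c * ‖x‖ ≤ ‖S x‖) (hdS : ∀ x, ‖S x‖ ≤ d * ‖x‖)
    (hcinj : ∀ x, S x = (c : ℂ) • x → x = 0) (hdinj : ∀ x, S x = (d : ℂ) • x → x = 0) :
    ∃ (K : Type u) (_ : NormedAddCommGroup K) (_ : InnerProductSpace ℂ K)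
      (_ : CompleteSpace K) (B : K →L[ℂ] K), B.IsPositive ∧
      StrictLess ((c : ℂ) • ContinuousLinearMap.id ℂ K) B ∧
      StrictLess B ((d : ℂ) • ContinuousLinearMap.id ℂ K) ∧
      UnitarilyEquivalent S (directSum B (-B)) := by
  have hinj : ∀ x, S x = 0 → x = 0 := fun x hx => by
    rcases hc.eq_or_lt with h0 | h0
    · exact hcinj x (by simp [hx, ← h0])
    · have h1 := hcS x
      rw [hx, norm_zero] at h1
      exact norm_le_zero_iff.1 (nonpos_of_mul_nonpos_right h1 h0)
  obtain ⟨E, hE, hEE, hED, hEc⟩ := exists_polar_sign hS hinj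
  have hJE : J * E = -(E * J) := by
    simpa using hEc J (-1) (by norm_num) (by simpa using hJS)
  have hSE : S * E = E * S := by
    simpa using hEc S 1 (by norm_num) (by simp)
  have hDE : E * S = CFC.abs S := by
    conv_lhs => rw [← hED]
    rw [← mul_assoc, hEE, one_mul]
  have ap : ∀ {F G : H →L[ℂ] H}, F = G → ∀ x, F x = G x := fun h x => by rw [h]
  have pJJ : ∀ x, J (J x) = x := ap hJJ
  have pEE : ∀ x, E (E x) = x := ap hEE
  have pJS : ∀ x, J (S x) = -S (J x) := ap hJS
  have pJE : ∀ x, J (E x) = -E (J x) := ap hJE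
  have pSE : ∀ x, S (E x) = E (S x) := ap hSE
  -- The positive spectral subspace of `S`, where `S = |S|`; `J` carries it onto its orthogonal
  -- complement.
  set M : Submodule ℂ H := (E - 1).ker with hM
  have hMc : IsClosed (M : Set H) := (E - 1).isClosed_ker
  have : CompleteSpace M := hMc.completeSpace_coe
  have hmem : ∀ x, x ∈ M ↔ E x = x := fun x => by
    rw [hM, LinearMap.mem_ker]
    simp [sub_eq_zero]
  have hSM : ∀ x : M, S x ∈ M := fun x => by
    rw [hmem, ← pSE, (hmem _).1 x.2]
  have hSabs : ∀ x : M, S x = CFC.abs S x := fun x => by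
    rw [← hDE]
    exact ((hmem _).1 (hSM x)).symm
  let B : M →L[ℂ] M := (S ∘L M.subtypeL).codRestrict M hSM
  have hBs : B.toLinearMap.IsSymmetric := fun x y => by
    change ⟪S x, (y : H)⟫_ℂ = ⟪(x : H), S y⟫_ℂ
    exact inner_apply_comm hS _ _
  have hids : ∀ r : ℝ, ((r : ℂ) • ContinuousLinearMap.id ℂ M).toLinearMap.IsSymmetric := by
    intro r x y
    change ⟪(r : ℂ) • (x : H), (y : H)⟫_ℂ = ⟪(x : H), (r : ℂ) • (y : H)⟫_ℂ
    rw [inner_smul_left, inner_smul_right, Complex.conj_ofReal]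
  have hre : ∀ {F G : H →L[ℂ] H}, F ≤ G → ∀ x, 0 ≤ RCLike.re ⟪G x - F x, x⟫_ℂ := by
    intro F G h x
    exact ((ContinuousLinearMap.le_def _ _).1 h).re_inner_nonneg_left x
  have hlow : (c : ℂ) • (1 : H →L[ℂ] H) ≤ CFC.abs S := by
    rw [← abs_ofReal_smul_one hc]
    refine abs_le_abs_of_norm_le fun x => ?_
    simpa [norm_smul, abs_of_nonneg hc] using hcS x
  have hupp : CFC.abs S ≤ (d : ℂ) • (1 : H →L[ℂ] H) := by
    rw [← abs_ofReal_smul_one hd]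
    refine abs_le_abs_of_norm_le fun x => ?_
    simpa [norm_smul, abs_of_nonneg hd] using hdS x
  refine ⟨M, inferInstance, inferInstance, inferInstance, B, ?_, ⟨?_, ?_⟩, ⟨?_, ?_⟩, ?_⟩
  · rw [ContinuousLinearMap.isPositive_def]
    refine ⟨hBs, fun x => ?_⟩
    have := hre (CFC.abs_nonneg S) x
    rw [← hSabs, zero_apply, sub_zero] at this
    exact this
  · rw [ContinuousLinearMap.isPositive_def]
    refine ⟨hBs.sub (hids c), fun x => ?_⟩
    have := hre hlow x
    rw [← hSabs] at this
    exact this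
  · rw [injective_iff_map_eq_zero]
    intro x hx
    refine Subtype.ext (hcinj x ?_)
    exact congrArg Subtype.val (sub_eq_zero.1 hx)
  · rw [ContinuousLinearMap.isPositive_def]
    refine ⟨(hids d).sub hBs, fun x => ?_⟩
    have := hre hupp x
    rw [← hSabs] at this
    exact this
  · rw [injective_iff_map_eq_zero]
    intro x hx
    refine Subtype.ext (hdinj x ?_)
    exact (congrArg Subtype.val (sub_eq_zero.1 hx)).symm
  · have hort : ∀ x y : M, ⟪(x : H), J y⟫_ℂ = 0 := fun x y => by
      have h1 := inner_apply_comm hE (x : H) (J y)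
      have h2 : E (J y) = -J y := by
        rw [← neg_eq_iff_eq_neg, ← pJE, (hmem _).1 y.2]
      rw [(hmem _).1 x.2, h2, inner_neg_right] at h1
      exact self_eq_neg.1 h1
    have hnJ := norm_apply_of_isSelfAdjoint_of_mul_self hJ hJJ
    let V₀ : WithLp 2 (M × M) →ₗ[ℂ] H :=
      { toFun := fun z => (z.fst : H) + J z.snd
        map_add' := fun z w => by
          simp only [WithLp.add_fst, WithLp.add_snd, Submodule.coe_add, map_add]
          abel
        map_smul' := fun r z => by simp }
    let V : WithLp 2 (M × M) →ₗᵢ[ℂ] H :=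
      { toLinearMap := V₀
        norm_map' := fun z => by
          have h1 : ‖(z.fst : H) + J z.snd‖ ^ 2 = ‖z‖ ^ 2 := by
            rw [norm_add_sq (𝕜 := ℂ), hort, hnJ, WithLp.prod_norm_sq_eq_of_L2]
            simp
          exact (sq_eq_sq₀ (norm_nonneg _) (norm_nonneg _)).1 h1 }
    have hV : ∀ z, V z = (z.fst : H) + J z.snd := fun z => rfl
    have hVs : Function.Surjective V := fun x => by
      have h1 : (2⁻¹ : ℂ) • (x + E x) ∈ M := by
        rw [hmem, map_smul, map_add, pEE, add_comm]
      have h2 : (2⁻¹ : ℂ) • J (x - E x) ∈ M := by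
        rw [hmem, map_smul, ← neg_inj, ← smul_neg, ← pJE, map_sub, pEE, ← smul_neg, ← map_neg,
          neg_sub]
      refine ⟨WithLp.toLp 2 (⟨_, h1⟩, ⟨_, h2⟩), ?_⟩
      rw [hV]
      change (2⁻¹ : ℂ) • (x + E x) + J ((2⁻¹ : ℂ) • J (x - E x)) = x
      rw [map_smul, pJJ]
      module
    refine ⟨(LinearIsometryEquiv.ofSurjective V hVs).symm, fun x => ?_⟩
    obtain ⟨z, rfl⟩ := (LinearIsometryEquiv.ofSurjective V hVs).surjective x
    rw [LinearIsometryEquiv.symm_apply_apply, LinearIsometryEquiv.symm_apply_eq, directSum_apply]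
    change S (V z) = V _
    rw [hV, hV, map_add]
    change _ = S z.fst + J (-S z.snd)
    rw [map_neg, pJS, neg_neg]

end Splitting

/-! ### From a pencil to the splitting. -/

section Pencil

open scoped InnerProductSpace

variable {H : Type u} [NormedAddCommGroup H] [InnerProductSpace ℂ H]

theorem IsInGenericPosition.eq_zero {T : H →L[ℂ] H} {l : ℝ} (h : IsInGenericPosition T l) {x : H}
    {μ : ℂ} (hμ : μ = 0 ∨ μ = 1 ∨ μ = l ∨ μ = 1 + l) (hx : T x = μ • x) : x = 0 := by
  obtain ⟨h0, h1, h2, h3⟩ := h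
  rcases hμ with rfl | rfl | rfl | rfl
  · exact (Submodule.eq_bot_iff _).1 h0 x (by simpa using hx)
  · exact (Submodule.eq_bot_iff _).1 h1 x (by simpa [sub_eq_zero] using hx)
  · exact (Submodule.eq_bot_iff _).1 h2 x (by simpa [sub_eq_zero] using hx)
  · exact (Submodule.eq_bot_iff _).1 h3 x (by simpa [sub_eq_zero] using hx)

/-- Shifted back by `(1 + l)/2`, the endpoints of the interval for `B` are values excluded as
eigenvalues of `T`. -/
theorem half_abs_one_sub_abs_mem (l : ℝ) :
    (1 + l) / 2 + abs (1 - |l|) / 2 ∈ ({0, 1, l, 1 + l} : Set ℝ) := by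
  simp only [Set.mem_insert_iff, Set.mem_singleton_iff]
  rcases abs_cases l with ⟨h, _⟩ | ⟨h, _⟩ <;> rcases abs_cases (1 - |l|) with ⟨h', _⟩ | ⟨h', _⟩ <;>
    rw [h', h] <;> ring_nf <;> simp

theorem half_one_add_abs_mem (l : ℝ) :
    (1 + l) / 2 + (1 + |l|) / 2 ∈ ({0, 1, l, 1 + l} : Set ℝ) := by
  simp only [Set.mem_insert_iff, Set.mem_singleton_iff]
  rcases abs_cases l with ⟨h, _⟩ | ⟨h, _⟩ <;> rw [h] <;> ring_nf <;> simp

theorem IsInGenericPosition.eq_zero_of_shift {T : H →L[ℂ] H} {l : ℝ}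
    (h : IsInGenericPosition T l) {r : ℝ}
    (hr : (1 + l) / 2 + r ∈ ({0, 1, l, 1 + l} : Set ℝ)) {x : H}
    (hx : (T - (((1 + l) / 2 : ℝ) : ℂ) • ContinuousLinearMap.id ℂ H) x = (r : ℂ) • x) :
    x = 0 := by
  refine h.eq_zero (μ := (((1 + l) / 2 + r : ℝ) : ℂ)) ?_ ?_
  · simp only [Set.mem_insert_iff, Set.mem_singleton_iff] at hr
    exact_mod_cast hr
  · rw [Complex.ofReal_add, add_smul, ← hx]
    simp

variable [CompleteSpace H]

theorem isSelfAdjoint_ofReal_smul {A : H →L[ℂ] H} (hA : IsSelfAdjoint A) (r : ℝ) :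
    IsSelfAdjoint ((r : ℂ) • A) :=
  IsSelfAdjoint.smul (Complex.conj_ofReal r) hA

theorem isSelfAdjoint_two_smul_sub_one {P : H →L[ℂ] H} (hP : IsStarProjection P) :
    IsSelfAdjoint ((2 : ℂ) • P - 1) := by
  have := isSelfAdjoint_ofReal_smul hP.isSelfAdjoint 2
  push_cast at this
  exact this.sub (.one _)

theorem two_smul_sub_one_mul_self {P : H →L[ℂ] H} (hP : IsStarProjection P) :
    ((2 : ℂ) • P - 1) * ((2 : ℂ) • P - 1) = 1 := by
  simp only [sub_mul, mul_sub, smul_mul_assoc, mul_smul_comm, hP.isIdempotentElem.eq, one_mul,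
    mul_one]
  module

/-- The commutator of two projections whose pencil is in generic position is injective. -/
theorem commutator_injective {P Q : H →L[ℂ] H} (hP : IsStarProjection P)
    (hQ : IsStarProjection Q) {l : ℝ} (h : IsInGenericPosition ((l : ℂ) • P + Q) l) {x : H}
    (hx : P (Q x) = Q (P x)) : x = 0 := by
  have pP : ∀ y, P (P y) = P y := fun y =>
    congrArg (fun F : H →L[ℂ] H => F y) hP.isIdempotentElem.eq
  have pQ : ∀ y, Q (Q y) = Q y := fun y =>
    congrArg (fun F : H →L[ℂ] H => F y) hQ.isIdempotentElem.eq
  -- `P Q x = Q P x` is fixed by both projections, hence killed by `T - (1 + l)`. Then `P x`, `Q x`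
  -- and `x` fall to `l`, `1` and `0` in turn.
  have hPQ : P (Q x) = 0 := by
    refine h.eq_zero (μ := 1 + l) (by simp) ?_
    have e : Q (P (Q x)) = P (Q x) := by rw [hx, pQ]
    simp only [add_apply, smul_apply, pP, e]
    module
  have hPx : P x = 0 := by
    refine h.eq_zero (μ := l) (by simp) ?_
    simp [pP, ← hx, hPQ]
  have hQx : Q x = 0 := by
    refine h.eq_zero (μ := 1) (by simp) ?_
    simp [pQ, hPQ]
  exact h.eq_zero (μ := 0) (by simp) (by simp [hPx, hQx])

theorem exists_splitting_of_isPencilAt {T : H →L[ℂ] H} {l : ℝ} (hT : IsSelfAdjoint T)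
    (hgen : IsInGenericPosition T l) (hpen : IsPencilAt T l) :
    ∃ (K : Type u) (_ : NormedAddCommGroup K) (_ : InnerProductSpace ℂ K)
      (_ : CompleteSpace K) (B : K →L[ℂ] K), B.IsPositive ∧
      StrictLess (((abs (1 - |l|) / 2 : ℝ) : ℂ) • ContinuousLinearMap.id ℂ K) B ∧
      StrictLess B ((((1 + |l|) / 2 : ℝ) : ℂ) • ContinuousLinearMap.id ℂ K) ∧
      UnitarilyEquivalent (T - (((1 + l) / 2 : ℝ) : ℂ) • ContinuousLinearMap.id ℂ H)
        (directSum B (-B)) := by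
  obtain ⟨P, Q, hP, hQ, -, -, rfl⟩ := hpen
  have hid : ContinuousLinearMap.id ℂ H = 1 := rfl
  set S : H →L[ℂ] H :=
    (l : ℂ) • P + Q - (((1 + l) / 2 : ℝ) : ℂ) • ContinuousLinearMap.id ℂ H with hSdef
  have hS : IsSelfAdjoint S := hT.sub (isSelfAdjoint_ofReal_smul (.one _) _)
  have hsym : (2 : ℂ) • S = (l : ℂ) • ((2 : ℂ) • P - 1) + ((2 : ℂ) • Q - 1) := by
    rw [hSdef, hid]
    push_cast
    module
  have hnorm : ∀ x, ∃ y z : H, ‖y‖ = ‖x‖ ∧ ‖z‖ = ‖x‖ ∧ (2 : ℂ) • S x = (l : ℂ) • y + z :=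
    fun x => ⟨((2 : ℂ) • P - 1) x, ((2 : ℂ) • Q - 1) x,
      norm_apply_of_isSelfAdjoint_of_mul_self (isSelfAdjoint_two_smul_sub_one hP)
        (two_smul_sub_one_mul_self hP) x,
      norm_apply_of_isSelfAdjoint_of_mul_self (isSelfAdjoint_two_smul_sub_one hQ)
        (two_smul_sub_one_mul_self hQ) x,
      congrArg (fun F : H →L[ℂ] H => F x) hsym⟩
  have hPP := hP.isIdempotentElem.eq
  have hQQ := hQ.isIdempotentElem.eq
  -- The factor `i` makes the skew-adjoint commutator self-adjoint.
  set X : H →L[ℂ] H := Complex.I • (P * Q - Q * P) with hXdef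
  have hX : IsSelfAdjoint X := by
    rw [isSelfAdjoint_iff, hXdef, star_smul, star_sub, star_mul, star_mul,
      hP.isSelfAdjoint.star_eq, hQ.isSelfAdjoint.star_eq]
    simp only [Complex.star_def, Complex.conj_I]
    module
  have hXinj : ∀ x, X x = 0 → x = 0 := fun x hx => by
    refine commutator_injective hP hQ hgen ?_
    have : (P * Q - Q * P) x = 0 := by
      simpa [hXdef, Complex.I_ne_zero] using hx
    exact sub_eq_zero.1 this
  have hPQP : P * (P * Q) = P * Q := by rw [← mul_assoc, hPP]
  have hQQP : Q * (Q * P) = Q * P := by rw [← mul_assoc, hQQ]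
  have hSX : S * X = (-1 : ℂ) • (X * S) := by
    rw [hXdef, hSdef, hid]
    push_cast
    simp only [mul_add, add_mul, mul_sub, sub_mul, smul_mul_assoc, mul_smul_comm, mul_assoc, hPP,
      hQQ, hPQP, hQQP, one_mul, mul_one]
    module
  obtain ⟨J, hJ, hJJ, -, hJc⟩ := exists_polar_sign hX hXinj
  have hJS : J * S = -(S * J) := by
    rw [hJc S (-1) (by norm_num) hSX]
    simp
  refine exists_splitting hS hJ hJJ hJS (by positivity) (by positivity)
    (fun x => ?_) (fun x => ?_) (fun x hx => ?_) (fun x hx => ?_)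
  · obtain ⟨y, z, hy, hz, e⟩ := hnorm x
    have e' := congrArg norm e
    rw [norm_smul, RCLike.norm_ofNat] at e'
    have h1 : |‖(l : ℂ) • y‖ - ‖z‖| ≤ ‖(l : ℂ) • y + z‖ := by
      simpa using abs_norm_sub_norm_le ((l : ℂ) • y) (-z)
    rw [norm_smul, hy, hz, Complex.norm_real, Real.norm_eq_abs,
      show |l| * ‖x‖ - ‖x‖ = -((1 - |l|) * ‖x‖) by ring, abs_neg, abs_mul, abs_norm] at h1
    linarith
  · obtain ⟨y, z, hy, hz, e⟩ := hnorm x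
    have e' := congrArg norm e
    rw [norm_smul, RCLike.norm_ofNat] at e'
    have h1 := norm_add_le ((l : ℂ) • y) z
    rw [norm_smul, hy, hz, Complex.norm_real, Real.norm_eq_abs] at h1
    linarith
  · exact hgen.eq_zero_of_shift (half_abs_one_sub_abs_mem l) hx
  · exact hgen.eq_zero_of_shift (half_one_add_abs_mem l) hx

end Pencil

/-! ### Functional calculus for the converse. -/

section Converse

open scoped InnerProductSpace

variable {H : Type u} [NormedAddCommGroup H] [InnerProductSpace ℂ H]

theorem ofReal_smul_id_eq_algebraMap (c : ℝ) :
    (c : ℂ) • ContinuousLinearMap.id ℂ H = algebraMap ℝ (H →L[ℂ] H) c := by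
  ext x
  simp [Algebra.algebraMap_eq_smul_one]

variable [CompleteSpace H]

/-- If `a` and `2S - l a` are self-adjoint unitaries, then `S + (1 + l)/2` is a pencil. -/
theorem isPencilAt_of_symmetry {T a : H →L[ℂ] H} {l : ℝ} [Nontrivial H]
    (hT : IsSelfAdjoint T) (hgen : IsInGenericPosition T l) (ha : IsSelfAdjoint a)
    (haa : a * a = 1)
    (hbb : ((2 : ℂ) • T - (1 + l : ℂ) • 1 - (l : ℂ) • a) *
      ((2 : ℂ) • T - (1 + l : ℂ) • 1 - (l : ℂ) • a) = 1) : IsPencilAt T l := by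
  have key : ∀ b : H →L[ℂ] H, IsSelfAdjoint b → b * b = 1 →
      IsStarProjection ((2⁻¹ : ℂ) • (1 + b)) := fun b hb hb2 => by
    refine ⟨?_, ?_⟩
    · change _ * _ = _
      simp only [smul_mul_assoc, mul_smul_comm, mul_add, add_mul, hb2, one_mul, mul_one]
      module
    · have := isSelfAdjoint_ofReal_smul ((IsSelfAdjoint.one _).add hb) 2⁻¹
      push_cast at this
      exact this
  have hb : IsSelfAdjoint ((2 : ℂ) • T - (1 + l : ℂ) • 1 - (l : ℂ) • a) := by
    have h1 := isSelfAdjoint_ofReal_smul hT 2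
    have h2 := isSelfAdjoint_ofReal_smul (IsSelfAdjoint.one (H →L[ℂ] H)) (1 + l)
    push_cast at h1 h2
    exact (h1.sub h2).sub (isSelfAdjoint_ofReal_smul ha l)
  set b := (2 : ℂ) • T - (1 + l : ℂ) • 1 - (l : ℂ) • a with hbdef
  have hP := key a ha haa
  have hQ := key b hb hbb
  have hsum : T = (l : ℂ) • ((2⁻¹ : ℂ) • (1 + a)) + (2⁻¹ : ℂ) • (1 + b) := by
    rw [hbdef]
    module
  set P := (2⁻¹ : ℂ) • (1 + a)
  set Q := (2⁻¹ : ℂ) • (1 + b)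
  -- If `P` or `Q` vanished, `T` would be a multiple `μ R` of a projection; the range of `R` would
  -- then consist of excluded eigenvectors, forcing `T = 0`.
  have hne : ∀ (R : H →L[ℂ] H) (μ : ℂ), IsStarProjection R →
      (μ = 0 ∨ μ = 1 ∨ μ = l ∨ μ = 1 + l) → T ≠ μ • R := fun R μ hR hμ e => by
    have hR0 : ∀ x, R x = 0 := fun x => by
      refine hgen.eq_zero hμ ?_
      rw [e, smul_apply]
      exact congrArg (fun F : H →L[ℂ] H => μ • F x) hR.isIdempotentElem.eq
    obtain ⟨x, hx⟩ := exists_ne (0 : H)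
    exact hx (hgen.eq_zero (μ := 0) (by simp) (by simp [e, hR0]))
  refine ⟨P, Q, hP, hQ, fun h0 => ?_, fun h0 => ?_, hsum⟩
  · exact hne Q 1 hQ (by simp) (by rw [hsum, h0]; simp)
  · exact hne P l hP (by simp) (by rw [hsum, h0]; simp)

/-- The operators `M = f(B)` and `N = √(1 - f²)(B)`, where `f(t) = (4t² + l² - 1) / (4lt)`. -/
theorem exists_cos_sin {B : H →L[ℂ] H} {l : ℝ} (hl : l ≠ 0) (hB : IsSelfAdjoint B)
    (h₁ : ((abs (1 - |l|) / 2 : ℝ) : ℂ) • ContinuousLinearMap.id ℂ H ≤ B)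
    (h₂ : B ≤ (((1 + |l|) / 2 : ℝ) : ℂ) • ContinuousLinearMap.id ℂ H) :
    ∃ M N : H →L[ℂ] H, IsSelfAdjoint M ∧ IsSelfAdjoint N ∧ M * M + N * N = 1 ∧
      M * N = N * M ∧ B * N = N * B ∧ M * B = B * M ∧
      (4 * l : ℂ) • (B * M) = (4 : ℂ) • (B * B) + ((l : ℂ) ^ 2 - 1) • 1 := by
  rw [ofReal_smul_id_eq_algebraMap] at h₁ h₂
  have hspec1 := (algebraMap_le_iff_le_spectrum hB).1 h₁
  have hspec2 := (le_algebraMap_iff_spectrum_le hB).1 h₂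
  set f : ℝ → ℝ := fun t => (4 * t ^ 2 + l ^ 2 - 1) / (4 * l * t) with hf
  have hl2 : |l| ^ 2 = l ^ 2 := sq_abs l
  have hmul : ∀ t ∈ spectrum ℝ B, 4 * l * (t * f t) = 4 * t ^ 2 + l ^ 2 - 1 := fun t ht => by
    -- Zero lies in the spectrum only if `|l| = 1`; there `f t = t / l`, which agrees with the
    -- default value `0 / 0 = 0`.
    rcases eq_or_ne t 0 with rfl | h0
    · have h3 := hspec1 0 ht
      have h4 : 1 - |l| = 0 := abs_eq_zero.1 (le_antisymm (by linarith) (abs_nonneg _))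
      have h5 : |l| = 1 := by linarith
      rw [h5] at hl2
      simp [← hl2]
    · rw [hf]
      field_simp
  have hcont : ContinuousOn f (spectrum ℝ B) := by
    rcases eq_or_ne |l| 1 with h1 | h1
    · rw [h1] at hl2
      have : f = fun t => t / l := by
        funext t
        rw [hf]
        rcases eq_or_ne t 0 with rfl | h0
        · simp
        · simp only [← hl2]
          field_simp
          ring
      rw [this]
      fun_prop
    · have hpos : ∀ t ∈ spectrum ℝ B, 4 * l * t ≠ 0 := fun t ht => by
        have h3 := hspec1 t ht
        have h4 : 0 < abs (1 - |l|) := abs_pos.2 (sub_ne_zero.2 h1.symm)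
        have h5 : t ≠ 0 := by linarith
        positivity
      exact ContinuousOn.div (by fun_prop) (by fun_prop) hpos
  have hle : ∀ t ∈ spectrum ℝ B, f t ^ 2 ≤ 1 := fun t ht => by
    have h3 := hspec1 t ht
    have h4 := hspec2 t ht
    have h5 := le_abs_self (1 - |l|)
    have h6 := neg_abs_le (1 - |l|)
    have hl0 : 0 < |l| := abs_pos.2 hl
    have h7 : 0 ≤ t := by linarith [abs_nonneg (1 - |l|)]
    rcases h7.eq_or_lt with rfl | h7
    · simp [hf]
    · rw [sq_le_one_iff_abs_le_one, hf, abs_div, div_le_one (by positivity), abs_mul, abs_mul,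
        abs_of_pos h7, abs_le, ← hl2]
      norm_num
      constructor
      -- The two inequalities are `(2t + |l|)² ≥ 1` and `(2t - |l|)² ≤ 1`, factored as differences
      -- of squares.
      · nlinarith [mul_nonneg (show 0 ≤ 2 * t + |l| - 1 by linarith)
          (show 0 ≤ 2 * t + |l| + 1 by linarith)]
      · nlinarith [mul_nonneg (show 0 ≤ 1 - 2 * t + |l| by linarith)
          (show 0 ≤ 1 + 2 * t - |l| by linarith)]
  have hcont' : ContinuousOn (fun t => Real.sqrt (1 - f t ^ 2)) (spectrum ℝ B) :=
    (continuousOn_const.sub (hcont.pow 2)).sqrt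
  have hid : cfc (fun t : ℝ => t) B = B := cfc_id' ℝ B
  refine ⟨cfc f B, cfc (fun t => Real.sqrt (1 - f t ^ 2)) B, cfc_predicate _ _,
    cfc_predicate _ _, ?_, (cfc_commute_cfc _ _ B).eq, ?_, ?_, ?_⟩
  · rw [← cfc_mul f f B, ← cfc_mul (fun t => Real.sqrt (1 - f t ^ 2)) _ B,
      ← cfc_add B (fun t => f t * f t) (fun t => √(1 - f t ^ 2) * √(1 - f t ^ 2))
        (hcont.mul hcont) (hcont'.mul hcont')]
    have : cfc (fun t => f t * f t + √(1 - f t ^ 2) * √(1 - f t ^ 2)) B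
        = cfc (fun _ : ℝ => (1 : ℝ)) B := cfc_congr fun t ht => by
      rw [Real.mul_self_sqrt (sub_nonneg.2 (hle t ht))]
      ring
    rw [this, cfc_const_one ℝ B]
  · exact ((Commute.refl B).cfc_real _).eq.symm
  · exact ((Commute.refl B).cfc_real _).eq
  · have e1 : cfc (fun t => 4 * l * (t * f t)) B = (4 * l) • (B * cfc f B) := by
      rw [cfc_const_mul (4 * l) (fun t => t * f t) B (continuousOn_id.mul hcont),
        cfc_mul (fun t => t) f B continuousOn_id hcont, hid]
    have e2 : cfc (fun t : ℝ => 4 * t ^ 2 + (l ^ 2 - 1)) B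
        = (4 : ℝ) • (B * B) + algebraMap ℝ _ (l ^ 2 - 1) := by
      rw [cfc_add_const (l ^ 2 - 1) (fun t : ℝ => 4 * t ^ 2) B,
        cfc_const_mul 4 (fun t : ℝ => t ^ 2) B, cfc_pow_id B 2, sq]
    have e0 : cfc (fun t => 4 * l * (t * f t)) B = cfc (fun t : ℝ => 4 * t ^ 2 + (l ^ 2 - 1)) B :=
      cfc_congr fun t ht => by simpa only [add_sub_assoc] using hmul t ht
    have e3 := (e1.symm.trans e0).trans e2
    rw [← ofReal_smul_id_eq_algebraMap] at e3
    refine ContinuousLinearMap.ext fun x => ?_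
    have e4 := congrArg (fun F : H →L[ℂ] H => F x) e3
    simp only [smul_apply, add_apply] at e4 ⊢
    rw [← Complex.coe_smul, ← Complex.coe_smul] at e4
    push_cast at e4
    exact e4

end Converse

/-! ### The block reflection on `K ⊕ K`. -/

section Block

open scoped InnerProductSpace

variable {K : Type u} [NormedAddCommGroup K] [InnerProductSpace ℂ K]

/-- The block operator `[[M, N], [N, -M]]` on `K ⊕ K`. -/
noncomputable def reflectionBlock (M N : K →L[ℂ] K) : WithLp 2 (K × K) →L[ℂ] WithLp 2 (K × K) :=
  (WithLp.prodContinuousLinearEquiv 2 ℂ K K).symm.toContinuousLinearMap ∘L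
    ((M ∘L .fst ℂ K K + N ∘L .snd ℂ K K).prod (N ∘L .fst ℂ K K - M ∘L .snd ℂ K K)) ∘L
      (WithLp.prodContinuousLinearEquiv 2 ℂ K K).toContinuousLinearMap

theorem reflectionBlock_apply (M N : K →L[ℂ] K) (z : WithLp 2 (K × K)) :
    reflectionBlock M N z = WithLp.toLp 2 (M z.fst + N z.snd, N z.fst - M z.snd) := rfl

theorem reflectionBlock_reflectionBlock {M N : K →L[ℂ] K} (h : M * M + N * N = 1)
    (hMN : M * N = N * M) (z : WithLp 2 (K × K)) :
    reflectionBlock M N (reflectionBlock M N z) = z := by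
  have p1 : ∀ x, M (M x) + N (N x) = x := fun x => congrArg (fun F : K →L[ℂ] K => F x) h
  have p2 : ∀ x, M (N x) = N (M x) := fun x => congrArg (fun F : K →L[ℂ] K => F x) hMN
  rw [reflectionBlock_apply, reflectionBlock_apply]
  refine (WithLp.ofLp_injective 2) (Prod.ext ?_ ?_)
  · change M (M z.fst + N z.snd) + N (N z.fst - M z.snd) = z.fst
    rw [map_add, map_sub, p2]
    linear_combination (norm := module) p1 z.fst
  · change N (M z.fst + N z.snd) - M (N z.fst - M z.snd) = z.snd
    rw [map_add, map_sub, p2]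
    linear_combination (norm := module) p1 z.snd

theorem inner_reflectionBlock [CompleteSpace K] {M N : K →L[ℂ] K} (hM : IsSelfAdjoint M)
    (hN : IsSelfAdjoint N) (z w : WithLp 2 (K × K)) :
    ⟪reflectionBlock M N z, w⟫_ℂ = ⟪z, reflectionBlock M N w⟫_ℂ := by
  rw [reflectionBlock_apply, reflectionBlock_apply, WithLp.prod_inner_apply,
    WithLp.prod_inner_apply]
  change ⟪M z.fst + N z.snd, w.fst⟫_ℂ + ⟪N z.fst - M z.snd, w.snd⟫_ℂ =
    ⟪z.fst, M w.fst + N w.snd⟫_ℂ + ⟪z.snd, N w.fst - M w.snd⟫_ℂ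
  simp only [inner_add_left, inner_sub_left, inner_add_right, inner_sub_right,
    inner_apply_comm hM, inner_apply_comm hN]
  ring

/-- The operator `2 (B ⊕ -B) - l a` is an involution, where `a` is the block reflection. -/
theorem two_smul_directSum_sub_involutive {B M N : K →L[ℂ] K} {l : ℂ} (h : M * M + N * N = 1)
    (hMN : M * N = N * M) (hBN : B * N = N * B) (hMB : M * B = B * M)
    (hBM : (4 * l) • (B * M) = (4 : ℂ) • (B * B) + (l ^ 2 - 1) • 1) (z : WithLp 2 (K × K)) :
    ((2 : ℂ) • directSum B (-B) - l • reflectionBlock M N)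
      (((2 : ℂ) • directSum B (-B) - l • reflectionBlock M N) z) = z := by
  have p1 : ∀ x, M (M x) + N (N x) = x := fun x => congrArg (fun F : K →L[ℂ] K => F x) h
  have p2 : ∀ x, M (N x) = N (M x) := fun x => congrArg (fun F : K →L[ℂ] K => F x) hMN
  have p3 : ∀ x, B (N x) = N (B x) := fun x => congrArg (fun F : K →L[ℂ] K => F x) hBN
  have p4 : ∀ x, M (B x) = B (M x) := fun x => congrArg (fun F : K →L[ℂ] K => F x) hMB
  have p5 : ∀ x, (4 * l) • B (M x) = (4 : ℂ) • B (B x) + (l ^ 2 - 1) • x := fun x =>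
    congrArg (fun F : K →L[ℂ] K => F x) hBM
  set F := (2 : ℂ) • directSum B (-B) - l • reflectionBlock M N with hF
  have hF1 : ∀ z, (F z).fst = (2 : ℂ) • B z.fst - l • (M z.fst + N z.snd) := fun z => rfl
  have hF2 : ∀ z, (F z).snd = (2 : ℂ) • (-B z.snd) - l • (N z.fst - M z.snd) := fun z => rfl
  refine (WithLp.ofLp_injective 2) (Prod.ext ?_ ?_)
  · change (F (F z)).fst = z.fst
    rw [hF1, hF1, hF2]
    simp only [map_add, map_sub, map_neg, map_smul, p2, p3, p4]
    linear_combination (norm := module) (l ^ 2) • p1 z.fst - p5 z.fst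
  · change (F (F z)).snd = z.snd
    rw [hF2, hF1, hF2]
    simp only [map_add, map_sub, map_neg, map_smul, p2, p3, p4]
    linear_combination (norm := module) (l ^ 2) • p1 z.snd - p5 z.snd

theorem isPencilAt_of_unitarilyEquivalent {H : Type*} [NormedAddCommGroup H]
    [InnerProductSpace ℂ H] [CompleteSpace H] [Nontrivial H] [CompleteSpace K] {l : ℝ}
    (hl : l ≠ 0) {T : H →L[ℂ] H} (hT : IsSelfAdjoint T) (hgen : IsInGenericPosition T l)
    {B : K →L[ℂ] K} (hB : IsSelfAdjoint B)
    (h₁ : ((abs (1 - |l|) / 2 : ℝ) : ℂ) • ContinuousLinearMap.id ℂ K ≤ B)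
    (h₂ : B ≤ (((1 + |l|) / 2 : ℝ) : ℂ) • ContinuousLinearMap.id ℂ K)
    (hU : UnitarilyEquivalent (T - (((1 + l) / 2 : ℝ) : ℂ) • ContinuousLinearMap.id ℂ H)
      (directSum B (-B))) : IsPencilAt T l := by
  obtain ⟨U, hU⟩ := hU
  obtain ⟨M, N, hM, hN, h, hMN, hBN, hMB, hBM⟩ := exists_cos_sin hl hB h₁ h₂
  let a : H →L[ℂ] H := (U.symm : WithLp 2 (K × K) →L[ℂ] H) ∘L
    reflectionBlock M N ∘L (U : H →L[ℂ] WithLp 2 (K × K))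
  have ha : ∀ x, U (a x) = reflectionBlock M N (U x) := fun x => U.apply_symm_apply _
  have hb : ∀ x, U (((2 : ℂ) • T - (1 + l : ℂ) • 1 - (l : ℂ) • a) x) =
      ((2 : ℂ) • directSum B (-B) - (l : ℂ) • reflectionBlock M N) (U x) := fun x => by
    change _ = (2 : ℂ) • directSum B (-B) (U x) - (l : ℂ) • reflectionBlock M N (U x)
    rw [← hU, ← ha, ← map_smul U, ← map_smul U, ← map_sub U]
    congr 1
    simp only [sub_apply, smul_apply, ContinuousLinearMap.id_apply, one_apply_eq_self]
    push_cast
    module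
  refine isPencilAt_of_symmetry hT hgen (a := a) ?_ ?_ ?_
  · rw [ContinuousLinearMap.isSelfAdjoint_iff_isSymmetric]
    intro x y
    change ⟪a x, y⟫_ℂ = ⟪x, a y⟫_ℂ
    rw [← U.inner_map_map, ← U.inner_map_map x, ha, ha, inner_reflectionBlock hM hN]
  · refine ContinuousLinearMap.ext fun x => U.injective ?_
    change U (a (a x)) = U x
    rw [ha, ha, reflectionBlock_reflectionBlock h hMN]
  · refine ContinuousLinearMap.ext fun x => U.injective ?_
    rw [mul_apply_eq_comp, hb, hb, two_smul_directSum_sub_involutive h hMN hBN hMB hBM]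
    rfl

end Block

end PencilOfProjections

theorem proposition2p1 {H : Type u} [NormedAddCommGroup H] [InnerProductSpace ℂ H]
    [CompleteSpace H] [Nontrivial H] (l : ℝ) (hl₁ : l ≠ -1) (hl₀ : l ≠ 0)
    (T : H →L[ℂ] H) (hT : IsSelfAdjoint T)
    (hgen : PencilOfProjections.IsInGenericPosition T l) :
    PencilOfProjections.IsPencilAt T l ↔
      ∃ (K : Type u) (_ : NormedAddCommGroup K) (_ : InnerProductSpace ℂ K)
        (_ : CompleteSpace K) (B : K →L[ℂ] K),
        B.IsPositive ∧
        PencilOfProjections.StrictLess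
          (((abs (1 - |l|) / 2 : ℝ) : ℂ) • ContinuousLinearMap.id ℂ K) B ∧
        PencilOfProjections.StrictLess
          B ((((1 + |l|) / 2 : ℝ) : ℂ) • ContinuousLinearMap.id ℂ K) ∧
        PencilOfProjections.UnitarilyEquivalent
          (T - (((1 + l) / 2 : ℝ) : ℂ) • ContinuousLinearMap.id ℂ H)
          (PencilOfProjections.directSum B (-B)) := by
  constructor
  · exact PencilOfProjections.exists_splitting_of_isPencilAt hT hgen
  · rintro ⟨K, _, _, _, B, hB, h₁, h₂, hU⟩
    exact PencilOfProjections.isPencilAt_of_unitarilyEquivalent hl₀ hT hgen hB.isSelfAdjoint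
      ((ContinuousLinearMap.le_def _ _).2 h₁.1) ((ContinuousLinearMap.le_def _ _).2 h₂.1) hU
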